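/- Let $x=(x^1,\dots,x^p)$ be independent variables, $u=(u^1,\dots,u^q)$ dependent variables, and write $u^\alpha_J$ for the derivative of $u^\alpha$ with multi-index $J=(j_1,\dots,j_p)$ and $(x,[u])$ for $x$, $u$ and finitely many derivatives of $u$. A function of $(x,[u])$ means a smooth function of finitely many of these coordinates, defined on (the preimage of) a fixed open subset $W$ of the jet space of order $n$. Let $D_i$ be the total derivative with respect to $x^i$, $D_J=D_1^{j_1}\cdots D_p^{j_p}$, $(-D)_J=(-1)^{|J|}D_J$, and $\operatorname{Div}A=D_iA^i$; repeated indices are summed. Let $F_\alpha(x,[u])=0$, $\alpha=1,\dots,q$, be a system of differential equations of order at most $n$ on $W$ which is analytic (the $F_\alpha$ are real analytic) and totally nondegenerate: for every $k\ge 0$ the $k$-th prolongation $\{D_JF_\alpha=0,\ |J|\le k\}$ is of maximal rank (at each of its points the Jacobian matrix of the functions $D_JF_\alpha$, $|J|\le k$, with respect to the coordinates $(x,[u])$ has linearly independent rows) and locally solvable (each of its points in the jet space of order $n+k$ is the $(n+k)$-jet of a smooth solution defined near the base point). Let $$X=\xi^i(x,[u])\frac{\partial}{\partial x^i}+\phi^\alpha(x,[u])\frac{\partial}{\partial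 u^\alpha}$$ be a (generalised) symmetry of the system, i.e. $\operatorname{pr}X(F_\alpha)=0$ along every smooth local solution for all $\alpha$, where $\operatorname{pr}X=\xi^iD_i+\sum_{\alpha,J}(D_JQ^\alpha)\,\partial/\partial u^\alpha_J$ and $Q^\alpha=\phi^\alpha-\xi^iu^\alpha_{x^i}$. Introduce further dependent variables $v=(v^1,\dots,v^q)$; functions of $(x,[u;v])$ are defined likewise, for $(x,[u])$ in $W$ and with no restriction on $v$ and its derivatives. Let $$\widehat L(x,[u;v])=(v^\alpha-u^\alpha)F_\alpha(x,[u]).$$ Then: 1. There are functions $\phi_*^\alpha(x,[u;v])$ such that $$Y=X+\phi_*^\alpha(x,[u;v])\frac{\partial}{\partial v^\alpha}$$ is a variational symmetry of the functional $\int\widehat L(x,[u;v])\,dx$, i.e. $\operatorname{pr}Y(\widehat L)+\widehat L\,D_i\xi^i=\operatorname{Div}A$ for some $p$-tuple $A$ of functions of $(x,[u;v])$. 2. There are finitely many functions $K^J_{\alpha\beta}(x,[u])$ such that, identically on $W$, $$\operatorname{pr}X(F_\alpha)=\sum_{\beta,J}K^J_{\alpha\beta}\,D_JF_\beta,\qquad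 \alpha=1,\dots,q;$$ and for every such choice of the $K^J_{\alpha\beta}$ the functions $$\phi_*^\alpha=\phi^\alpha-\sum_{\beta,J}(-D)_J\big[(v^\beta-u^\beta)K^J_{\beta\alpha}\big]-(v^\alpha-u^\alpha)D_i\xi^i$$ have the property in 1. -/

import Mathlib

open scoped ContDiff

noncomputable section

namespace JetCalculus

/-- Coordinates on the infinite jet space with `p` independent variables and dependent variables
indexed by `ι`: `Sum.inl i` is the independent variable `x^i`, and `Sum.inr (α, J)` is the
derivative coordinate `u^α_J`, where `J = (j_1, …, j_p)` is a multi-index. -/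
abbrev Coord (p : ℕ) (ι : Type) : Type := Fin p ⊕ ι × (Fin p → ℕ)

/-- Points `(x, [u])` of the infinite jet space (with the product topology). -/
abbrev Jet (p : ℕ) (ι : Type) : Type := Coord p ι → ℝ

section Basic

variable {p : ℕ} {ι : Type}

/-- The order of a jet coordinate: `0` for `x^i`, and `|J| = j_1 + ⋯ + j_p` for `u^α_J`. -/
def coordOrder : Coord p ι → ℕ
  | Sum.inl _ => 0
  | Sum.inr a => ∑ i, a.2 i

/-- Two infinite jets have the same image in the jet space of order `n`. -/
def AgreeUpTo (n : ℕ) (z z' : Jet p ι) : Prop :=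
  ∀ c : Coord p ι, coordOrder c ≤ n → z c = z' c

/-- `W` is (the preimage in the infinite jet space of) an open subset of the jet space of
order `n`. -/
structure IsJetDomain (n : ℕ) (W : Set (Jet p ι)) : Prop where
  isOpen : IsOpen W
  saturated : ∀ z z' : Jet p ι, AgreeUpTo n z z' → z ∈ W → z' ∈ W

/-- `P(x,[u])` is a differential function of class `C^r` on `W`: on `W` it is a `C^r` function of
finitely many jet coordinates. For `r = ∞` this is smoothness, for `r = ω` real analyticity. -/
def IsDiffFun (r : WithTop ℕ∞) (W : Set (Jet p ι)) (P : Jet p ι → ℝ) : Prop :=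
  ∃ (S : Finset (Coord p ι)) (G : (S → ℝ) → ℝ),
    ContDiffOn ℝ r G ((fun (z : Jet p ι) (c : S) => z c) '' W) ∧
      ∀ z ∈ W, P z = G (fun c : S => z c)

/-- On `W`, the function `P` depends only on the jet coordinates of order at most `n`. -/
def HasOrderLE (n : ℕ) (W : Set (Jet p ι)) (P : Jet p ι → ℝ) : Prop :=
  ∀ z ∈ W, ∀ z' ∈ W, AgreeUpTo n z z' → P z = P z'

/-- For a family of operators `T_1, …, T_p` and a multi-index `J`, the composite operator
`T_1^{j_1} T_2^{j_2} ⋯ T_p^{j_p}`. -/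
def multiIter {A : Type} (T : Fin p → A → A) (J : Fin p → ℕ) (a : A) : A :=
  (List.finRange p).foldr (fun i b => (T i)^[J i] b) a

/-- The infinite jet at `x` of a function `u = f(x)`: its coordinate `u^α_J` is
`∂^{|J|} f^α / ∂(x^1)^{j_1} ⋯ ∂(x^p)^{j_p}` at `x`. -/
def jetOf (f : (Fin p → ℝ) → ι → ℝ) (x : Fin p → ℝ) : Jet p ι :=
  Sum.elim x fun a =>
    multiIter (fun i (g : (Fin p → ℝ) → ℝ) y => fderiv ℝ g y (Pi.single i 1)) a.2
      (fun y => f y a.1) x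

/-- `u = f(x)` is a smooth solution on the open set `V` of the system `F_α(x,[u]) = 0`,
`α ∈ ι`, whose left-hand sides are defined on the jet domain `W`. -/
structure IsSolutionOn (V : Set (Fin p → ℝ)) (W : Set (Jet p ι)) (F : ι → Jet p ι → ℝ)
    (f : (Fin p → ℝ) → ι → ℝ) : Prop where
  isOpen : IsOpen V
  smooth : ∀ α, ContDiffOn ℝ ∞ (fun x => f x α) V
  mem : ∀ x ∈ V, jetOf f x ∈ W
  eq_zero : ∀ x ∈ V, ∀ α, F α (jetOf f x) = 0

variable [DecidableEq ι]

/-- The partial derivative `∂P/∂c` with respect to a jet coordinate `c`. -/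
def partialD (c : Coord p ι) (P : Jet p ι → ℝ) (z : Jet p ι) : ℝ :=
  deriv (fun t => P (Function.update z c t)) (z c)

/-- The total derivative `D_i P = ∂P/∂x^i + ∑_{α,J} u^α_{J+1_i} ∂P/∂u^α_J`. The sum has only
finitely many nonzero terms when `P` is a differential function. -/
def totalD (i : Fin p) (P : Jet p ι → ℝ) (z : Jet p ι) : ℝ :=
  partialD (Sum.inl i) P z +
    ∑ᶠ a : ι × (Fin p → ℕ),
      z (Sum.inr (a.1, a.2 + Pi.single i 1)) * partialD (Sum.inr a) P z

/-- The iterated total derivative `D_J = D_1^{j_1} ⋯ D_p^{j_p}`. -/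
def totalDMulti (J : Fin p → ℕ) (P : Jet p ι → ℝ) : Jet p ι → ℝ :=
  multiIter totalD J P

/-- The adjoint operator `(-D)_J = (-1)^{|J|} D_J`. -/
def negTotalDMulti (J : Fin p → ℕ) (P : Jet p ι → ℝ) (z : Jet p ι) : ℝ :=
  (-1) ^ (∑ i, J i) * totalDMulti J P z

/-- The divergence `Div A = D_i A^i` of a `p`-tuple of differential functions. -/
def totalDiv (A : Fin p → Jet p ι → ℝ) (z : Jet p ι) : ℝ :=
  ∑ i, totalD i (A i) z

/-- The characteristic `Q^α = φ^α - ξ^i u^α_{1_i}` of the generalised vector field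
`ξ^i ∂/∂x^i + φ^α ∂/∂u^α`. -/
def characteristic (ξ : Fin p → Jet p ι → ℝ) (φ : ι → Jet p ι → ℝ) (α : ι) (z : Jet p ι) : ℝ :=
  φ α z - ∑ i, ξ i z * z (Sum.inr (α, Pi.single i 1))

/-- The prolongation of the generalised vector field `X = ξ^i ∂/∂x^i + φ^α ∂/∂u^α`, applied to a
differential function `P`: `pr X (P) = ξ^i D_i P + ∑_{α,J} (D_J Q^α) ∂P/∂u^α_J`. -/
def prolong (ξ : Fin p → Jet p ι → ℝ) (φ : ι → Jet p ι → ℝ) (P : Jet p ι → ℝ) (z : Jet p ι) : ℝ :=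
  ∑ i, ξ i z * totalD i P z +
    ∑ᶠ a : ι × (Fin p → ℕ),
      totalDMulti a.2 (characteristic ξ φ a.1) z * partialD (Sum.inr a) P z

/-- `z` lies on the subvariety of the `k`-th prolongation of the system, i.e.
`D_J F_α = 0` at `z` for all `α` and all `|J| ≤ k`. -/
def OnProlongedSystem (k : ℕ) (W : Set (Jet p ι)) (F : ι → Jet p ι → ℝ) (z : Jet p ι) : Prop :=
  z ∈ W ∧ ∀ (α : ι) (J : Fin p → ℕ), ∑ i, J i ≤ k → totalDMulti J (F α) z = 0

/-- The `k`-th prolongation of the system is of maximal rank: at each point of its subvariety the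
rows of the Jacobian matrix of the functions `D_J F_α`, `|J| ≤ k`, with respect to all the jet
coordinates `(x,[u])`, are linearly independent. -/
def IsMaximalRank (k : ℕ) (W : Set (Jet p ι)) (F : ι → Jet p ι → ℝ) : Prop :=
  ∀ z, OnProlongedSystem k W F z →
    LinearIndependent ℝ
      (fun (a : ι × {J : Fin p → ℕ // ∑ i, J i ≤ k}) (c : Coord p ι) =>
        partialD c (totalDMulti a.2.1 (F a.1)) z)

/-- The `k`-th prolongation of a system of order `n` is locally solvable: each point of its
subvariety in the jet space of order `n + k` is the `(n + k)`-jet of a smooth solution defined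
near the base point. -/
def IsLocallySolvable (n k : ℕ) (W : Set (Jet p ι)) (F : ι → Jet p ι → ℝ) : Prop :=
  ∀ z, OnProlongedSystem k W F z →
    ∃ (V : Set (Fin p → ℝ)) (f : (Fin p → ℝ) → ι → ℝ),
      (fun i => z (Sum.inl i)) ∈ V ∧ IsSolutionOn V W F f ∧
        AgreeUpTo (n + k) (jetOf f (fun i => z (Sum.inl i))) z

/-- A system of order `n` is totally nondegenerate if the system and all its prolongations are of
maximal rank and locally solvable. -/
def IsTotallyNondegenerate (n : ℕ) (W : Set (Jet p ι)) (F : ι → Jet p ι → ℝ) : Prop :=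
  ∀ k : ℕ, IsMaximalRank k W F ∧ IsLocallySolvable n k W F

/-- The linearized symmetry condition: `X = ξ^i ∂/∂x^i + φ^α ∂/∂u^α` generates a (generalised)
symmetry of the system if `pr X (F_α) = 0` for all `α` whenever the system holds, i.e. along
every smooth local solution. -/
def IsSymmetry (W : Set (Jet p ι)) (F : ι → Jet p ι → ℝ)
    (ξ : Fin p → Jet p ι → ℝ) (φ : ι → Jet p ι → ℝ) : Prop :=
  ∀ (V : Set (Fin p → ℝ)) (f : (Fin p → ℝ) → ι → ℝ), IsSolutionOn V W F f →
    ∀ x ∈ V, ∀ α, prolong ξ φ (F α) (jetOf f x) = 0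

/-- `X = ξ^i ∂/∂x^i + φ^α ∂/∂u^α` is a (divergence) variational symmetry of the functional
`∫ L(x,[u]) dx`: it satisfies the infinitesimal invariance criterion
`pr X (L) + L D_i ξ^i = Div A` for some `p`-tuple `A` of smooth differential functions. -/
def IsVariationalSymmetry (W : Set (Jet p ι)) (L : Jet p ι → ℝ)
    (ξ : Fin p → Jet p ι → ℝ) (φ : ι → Jet p ι → ℝ) : Prop :=
  ∃ A : Fin p → Jet p ι → ℝ, (∀ i, IsDiffFun ∞ W (A i)) ∧
    ∀ z ∈ W, prolong ξ φ L z + L z * totalDiv ξ z = totalDiv A z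

/-- Multipliers in the linearized symmetry condition: smooth differential functions
`K^J_{αβ}(x,[u])`, with `J` in a finite set of multi-indices, such that
`pr X (F_α) = ∑_{β,J} K^J_{αβ} D_J F_β` identically on `W`. -/
def IsSymmetryMultiplier [Fintype ι] (W : Set (Jet p ι)) (F : ι → Jet p ι → ℝ)
    (ξ : Fin p → Jet p ι → ℝ) (φ : ι → Jet p ι → ℝ)
    (𝒥 : Finset (Fin p → ℕ)) (K : (Fin p → ℕ) → ι → ι → Jet p ι → ℝ) : Prop :=
  (∀ J ∈ 𝒥, ∀ α β, IsDiffFun ∞ W (K J α β)) ∧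
    ∀ z ∈ W, ∀ α, prolong ξ φ (F α) z = ∑ β, ∑ J ∈ 𝒥, K J α β z * totalDMulti J (F β) z

end Basic

section Extended

variable {p : ℕ} {ι : Type}

/-- The projection `(x,[u;v]) ↦ (x,[u])`. The dependent variables of the extended jet space are
indexed by `ι ⊕ ι`: `Sum.inl α` stands for `u^α` and `Sum.inr α` for the dummy variable `v^α`. -/
def forgetV (z : Jet p (ι ⊕ ι)) : Jet p ι :=
  Sum.elim (fun i => z (Sum.inl i)) fun a => z (Sum.inr (Sum.inl a.1, a.2))

/-- The function `v^α - u^α` on the extended jet space. -/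
def vSubU (α : ι) (z : Jet p (ι ⊕ ι)) : ℝ :=
  z (Sum.inr (Sum.inr α, 0)) - z (Sum.inr (Sum.inl α, 0))

/-- The generic modified formal Lagrangian `v^α F_α(x,[u]) - u^α F_α(x,[u])`. -/
def genericLagrangian [Fintype ι] (F : ι → Jet p ι → ℝ) (z : Jet p (ι ⊕ ι)) : ℝ :=
  ∑ α, z (Sum.inr (Sum.inr α, 0)) * F α (forgetV z) -
    ∑ α, z (Sum.inr (Sum.inl α, 0)) * F α (forgetV z)

/-- The coefficients `ξ^i(x,[u])`, regarded as functions of `(x,[u;v])`. -/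
def liftXi (ξ : Fin p → Jet p ι → ℝ) (i : Fin p) (z : Jet p (ι ⊕ ι)) : ℝ :=
  ξ i (forgetV z)

/-- The coefficients of `∂/∂u^α` and `∂/∂v^α` in `Y = X + φ_*^α(x,[u;v]) ∂/∂v^α`. -/
def extendPhi (φ : ι → Jet p ι → ℝ) (φs : ι → Jet p (ι ⊕ ι) → ℝ) :
    ι ⊕ ι → Jet p (ι ⊕ ι) → ℝ :=
  Sum.elim (fun α z => φ α (forgetV z)) φs

/-- The explicit coefficients
`φ_*^α = φ^α - ∑_{β,J} (-D)_J [(v^β - u^β) K^J_{βα}] - (v^α - u^α) D_i ξ^i`. -/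
def phiStar [Fintype ι] [DecidableEq ι] (ξ : Fin p → Jet p ι → ℝ) (φ : ι → Jet p ι → ℝ)
    (𝒥 : Finset (Fin p → ℕ)) (K : (Fin p → ℕ) → ι → ι → Jet p ι → ℝ)
    (α : ι) (z : Jet p (ι ⊕ ι)) : ℝ :=
  φ α (forgetV z) -
    ∑ β, ∑ J ∈ 𝒥, negTotalDMulti J (fun w => vSubU β w * K J β α (forgetV w)) z -
    vSubU α z * totalDiv (liftXi ξ) z

end Extended

end JetCalculus

end

open JetCalculus

/-! The prolongation of Y acts on functions of (x,[u]) as pr X does, so the Leibniz rule gives pr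
Y(L̂) = (φ_*^α - φ^α) F_α + (v^α - u^α) pr X(F_α). Once pr X(F_α) = K^J_{αβ} D_J F_β, integration by
parts moves each D_J from F_β onto (v^α - u^α) K^J_{αβ}. Modulo divergences, pr Y(L̂) + L̂ D_i ξ^i
is then a combination of the F_α whose coefficients vanish exactly by the choice of φ_*. This is
`isVariationalSymmetry_phiStar`, which rests on `prolong_genericLagrangian` and
`IsDiffFun.isDivergence_integration_by_parts`.

The substance is the existence of the multipliers, `exists_isSymmetryMultiplier`. The functions pr
X(F_α) involve finitely many coordinates, of order at most some k. Local solvability places a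
solution through every point of the k-th prolonged system, up to order n + k, so pr X(F_α) vanishes
on that whole variety. By maximal rank the functions D_J F_β with |J| ≤ k are part of a coordinate
system near each point of the variety, and Hadamard's lemma divides by them. Off the variety one
divides by a single nonzero D_J F_β. A partition of unity glues the local multipliers
(`exists_multipliers`).

The infinite jet space carries no norm; total derivatives and prolongations are therefore handled as
directional derivatives of functions of finitely many coordinates. -/

section

open Set Filter Topology

/-! ### Division of smooth functions in finite dimensions -/

section SmoothDivision

theorem hasFDerivAt_intervalIntegral_of_contDiff {E F : Type} [NormedAddCommGroup E]
    [NormedSpace ℝ E] [FiniteDimensional ℝ E] [NormedAddCommGroup F] [NormedSpace ℝ F]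
    [CompleteSpace F] {f : ℝ × E → F} (hf : ContDiff ℝ 1 f) (x : E) :
    HasFDerivAt (fun x => ∫ t in (0 : ℝ)..1, f (t, x))
      (∫ t in (0 : ℝ)..1, (fderiv ℝ f (t, x)).comp (ContinuousLinearMap.inr ℝ ℝ E)) x := by
  have hf' : Continuous fun z : ℝ × E =>
      (fderiv ℝ f z).comp (ContinuousLinearMap.inr ℝ ℝ E) :=
    (hf.continuous_fderiv one_ne_zero).clm_comp continuous_const
  have hslice : ∀ y : E, Continuous fun t : ℝ => (t, y) := fun y => by fun_prop
  -- The dominating constant comes from compactness of [0,1] times the closed unit ball around x.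
  obtain ⟨C, hC⟩ := ((isCompact_Icc (a := (0 : ℝ)) (b := 1)).prod
    (isCompact_closedBall x 1)).exists_bound_of_continuousOn hf'.continuousOn
  refine intervalIntegral.hasFDerivAt_integral_of_dominated_of_fderiv_le (bound := fun _ => C)
    (F' := fun y t => (fderiv ℝ f (t, y)).comp (ContinuousLinearMap.inr ℝ ℝ E))
    (Metric.closedBall_mem_nhds x one_pos)
    (Eventually.of_forall fun y => (hf.continuous.comp (hslice y)).aestronglyMeasurable)
    ((hf.continuous.comp (hslice x)).intervalIntegrable _ _)
    (hf'.comp (hslice x)).aestronglyMeasurable ?_ intervalIntegrable_const ?_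
  · refine Eventually.of_forall fun t ht y hy => hC (t, y) ⟨?_, hy⟩
    rw [uIoc_of_le zero_le_one] at ht
    exact ⟨ht.1.le, ht.2⟩
  · refine Eventually.of_forall fun t _ y _ => ?_
    exact ((hf.differentiable one_ne_zero) (t, y)).hasFDerivAt.comp y
      (hasFDerivAt_prodMk_right t y)

/-- The derivative is again a parameter integral, now with values in `E →L[ℝ] F`; the induction on
the order therefore quantifies over the target space. -/
theorem contDiff_intervalIntegral_of_contDiff {E F : Type} [NormedAddCommGroup E]
    [NormedSpace ℝ E] [FiniteDimensional ℝ E] [NormedAddCommGroup F] [NormedSpace ℝ F]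
    [CompleteSpace F] {f : ℝ × E → F} (hf : ContDiff ℝ ∞ f) :
    ContDiff ℝ ∞ fun x => ∫ t in (0 : ℝ)..1, f (t, x) := by
  suffices H : ∀ (n : ℕ) (F : Type) [NormedAddCommGroup F] [NormedSpace ℝ F] [CompleteSpace F]
      (f : ℝ × E → F), ContDiff ℝ ∞ f → ContDiff ℝ n fun x => ∫ t in (0 : ℝ)..1, f (t, x) from
    contDiff_infty.2 fun n => H n F f hf
  intro n
  induction n with
  | zero =>
    intro F _ _ _ f hf
    exact contDiff_zero.2 (continuous_iff_continuousAt.2 fun x =>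
      (hasFDerivAt_intervalIntegral_of_contDiff (hf.of_le (by simp)) x).continuousAt)
  | succ n ih =>
    intro F _ _ _ f hf
    have hd := fun x => hasFDerivAt_intervalIntegral_of_contDiff (hf.of_le (by simp)) x
    push_cast
    refine contDiff_succ_iff_fderiv.2 ⟨fun x => (hd x).differentiableAt, by simp, ?_⟩
    rw [funext fun x => (hd x).fderiv]
    exact ih _ (fun z => (fderiv ℝ f z).comp (ContinuousLinearMap.inr ℝ ℝ E))
      ((hf.fderiv_right (by simp)).clm_comp contDiff_const)

/-- **Hadamard's lemma**: a smooth function that vanishes on `{0} × G` is linear in the first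
variable, with smooth coefficients. -/
theorem exists_contDiff_clm_of_eq_zero {F G : Type} [NormedAddCommGroup F] [NormedSpace ℝ F]
    [FiniteDimensional ℝ F] [NormedAddCommGroup G] [NormedSpace ℝ G] [FiniteDimensional ℝ G]
    {h : F × G → ℝ} (hh : ContDiff ℝ ∞ h) (h0 : ∀ y, h (0, y) = 0) :
    ∃ k : F × G → F →L[ℝ] ℝ, ContDiff ℝ ∞ k ∧ ∀ z, h z = k z z.1 := by
  -- The coefficient is the integral over t in [0,1] of the partial derivative of h along F at (t
  -- z₁, z₂). The fundamental theorem of calculus along this segment gives the identity.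
  let f : ℝ × (F × G) → F →L[ℝ] ℝ := fun w =>
    (fderiv ℝ h (w.1 • w.2.1, w.2.2)).comp (ContinuousLinearMap.inl ℝ F G)
  have hf : ContDiff ℝ ∞ f := by
    refine ContDiff.clm_comp ?_ contDiff_const
    exact (hh.fderiv_right (m := ∞) (by simp)).comp (by fun_prop)
  refine ⟨_, contDiff_intervalIntegral_of_contDiff hf, fun z => ?_⟩
  have hcont : Continuous fun t : ℝ => f (t, z) := hf.continuous.comp (by fun_prop)
  have hder : ∀ t ∈ uIcc (0 : ℝ) 1,
      HasDerivAt (fun t : ℝ => h (t • z.1, z.2)) (f (t, z) z.1) t := by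
    intro t _
    have h1 : HasDerivAt (fun t : ℝ => (t • z.1, z.2)) (z.1, (0 : G)) t := by
      have := ((hasDerivAt_id t).smul_const z.1).prodMk (hasDerivAt_const t z.2)
      simpa using this
    exact ((hh.differentiable (by simp)) (t • z.1, z.2)).hasFDerivAt.comp_hasDerivAt t h1
  have hint := intervalIntegral.integral_eq_sub_of_hasDerivAt hder
    ((hcont.clm_apply continuous_const).intervalIntegrable _ _)
  rw [ContinuousLinearMap.intervalIntegral_apply (hcont.intervalIntegrable _ _), hint]
  simp [h0]

/-- A nonzero functional vanishing on a proper range would have as coordinates the coefficients of a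
linear relation between the `L i`. -/
theorem range_pi_eq_top_of_linearIndependent {E I : Type} [NormedAddCommGroup E]
    [NormedSpace ℝ E] [Fintype I] {L : I → E →L[ℝ] ℝ} (hL : LinearIndependent ℝ L) :
    (ContinuousLinearMap.pi L).range = ⊤ := by
  classical
  by_contra hne
  obtain ⟨f, hf0, hf⟩ := Submodule.exists_le_ker_of_lt_top _ (lt_top_iff_ne_top.2 hne)
  apply hf0
  have hsum : ∑ i, f (Pi.single i 1) • L i = 0 := by
    ext x
    have hx : f (ContinuousLinearMap.pi L x) = 0 := hf ⟨x, rfl⟩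
    rw [LinearMap.pi_apply_eq_sum_univ f] at hx
    have hs : ∀ i : I, (fun j => if i = j then (1 : ℝ) else 0) = Pi.single i 1 := fun i => by
      ext j; simp [Pi.single_apply, eq_comm]
    simpa [mul_comm, hs] using hx
  have hz := Fintype.linearIndependent_iff.1 hL _ hsum
  refine LinearMap.pi_ext' fun i => LinearMap.ext_ring ?_
  simpa using hz i

/-- Functions with linearly independent differentials at a common zero are, locally, part of a
smooth coordinate system. -/
theorem exists_straightening {E I : Type} [NormedAddCommGroup E] [NormedSpace ℝ E]
    [FiniteDimensional ℝ E] [Fintype I] {U : Set E} (hU : IsOpen U) {Δ : I → E → ℝ}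
    (hΔ : ∀ i, ContDiffOn ℝ ∞ (Δ i) U) {x₀ : E} (hx₀ : x₀ ∈ U)
    (hli : LinearIndependent ℝ fun i => fderiv ℝ (Δ i) x₀) :
    ∃ (G : Submodule ℝ E) (e : OpenPartialHomeomorph E ((I → ℝ) × G)),
      x₀ ∈ e.source ∧ e.source ⊆ U ∧ (∀ x, (e x).1 = fun i => Δ i x) ∧
        ContDiffOn ℝ ∞ e e.source ∧ ContDiffOn ℝ ∞ e.symm e.target := by
  let L : E →L[ℝ] (I → ℝ) := ContinuousLinearMap.pi fun i => fderiv ℝ (Δ i) x₀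
  have hL : L.range = ⊤ := range_pi_eq_top_of_linearIndependent hli
  -- A projection onto the kernel of the surjective differential completes it to an isomorphism, so
  -- the inverse function theorem applies to Φ.
  obtain ⟨π, hπ⟩ := L.ker_closedComplemented_of_finiteDimensional_range
  have hπr : π.range = ⊤ := LinearMap.range_eq_top.2 fun y => ⟨y, hπ y⟩
  let A : E ≃L[ℝ] (I → ℝ) × L.ker := ContinuousLinearMap.equivProdOfSurjectiveOfIsCompl L π hL hπr
    (LinearMap.isCompl_of_proj hπ)
  let Φ : E → (I → ℝ) × L.ker := fun x => (fun i => Δ i x, π x)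
  have hΦ : ∀ x ∈ U, ContDiffAt ℝ ∞ Φ x := fun x hx =>
    (contDiffAt_pi.2 fun i => (hΔ i).contDiffAt (hU.mem_nhds hx)).prodMk π.contDiff.contDiffAt
  have hΦ' : HasFDerivAt Φ (A : E →L[ℝ] (I → ℝ) × L.ker) x₀ := by
    have h1 : HasFDerivAt (fun x i => Δ i x) L x₀ := hasFDerivAt_pi.2 fun i =>
      (((hΔ i).contDiffAt (hU.mem_nhds hx₀)).differentiableAt (by simp)).hasFDerivAt
    exact h1.prodMk π.hasFDerivAt
  let e₀ := (hΦ x₀ hx₀).toOpenPartialHomeomorph Φ hΦ' (by simp)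
  have he₀ : (e₀ : E → (I → ℝ) × L.ker) = Φ := rfl
  -- Smoothness of the inverse is needed on the whole target, not only at the image of x₀; hence the
  -- restriction to the open set where the derivative stays invertible.
  let O : Set E := U ∩ fderiv ℝ Φ ⁻¹' range ((↑) : (E ≃L[ℝ] (I → ℝ) × L.ker) → _)
  have hO : IsOpen O := ContinuousOn.isOpen_inter_preimage
    (fun x hx => ((hΦ x hx).continuousAt_fderiv (by simp)).continuousWithinAt) hU
    ContinuousLinearEquiv.isOpen
  let e := e₀.restrOpen O hO
  have hsrc : e.source = e₀.source ∩ O := e₀.restrOpen_source O hO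
  have hmap : ∀ y ∈ e.target, e.symm y ∈ O := fun y hy =>
    (hsrc ▸ e.map_target hy : e.symm y ∈ e₀.source ∩ O).2
  refine ⟨L.ker, e, ?_, ?_, fun x => rfl, ?_, ?_⟩
  · rw [hsrc]
    exact ⟨(hΦ x₀ hx₀).mem_toOpenPartialHomeomorph_source hΦ' (by simp), hx₀, A, hΦ'.fderiv.symm⟩
  · rw [hsrc]
    exact fun x hx => hx.2.1
  · intro x hx
    rw [hsrc] at hx
    exact (hΦ x hx.2.1).contDiffWithinAt
  · intro y hy
    obtain ⟨hyU, B, hB⟩ := hmap y hy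
    refine (e.contDiffAt_symm (f₀' := B) hy ?_ (hΦ _ hyU)).contDiffWithinAt
    rw [hB]
    exact ((hΦ _ hyU).differentiableAt (by simp)).hasFDerivAt

/-- In straightening coordinates the Δ i are the first block of coordinates, so g vanishes where
that block is zero and Hadamard's lemma yields the multipliers. -/
theorem exists_local_multipliers {E I : Type} [NormedAddCommGroup E] [NormedSpace ℝ E]
    [FiniteDimensional ℝ E] [Fintype I] {U : Set E} (hU : IsOpen U) {Δ : I → E → ℝ}
    (hΔ : ∀ i, ContDiffOn ℝ ∞ (Δ i) U) {g : E → ℝ} (hg : ContDiffOn ℝ ∞ g U)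
    (hvan : ∀ x ∈ U, (∀ i, Δ i x = 0) → g x = 0) {x₀ : E} (hx₀ : x₀ ∈ U)
    (hli : LinearIndependent ℝ fun i => fderiv ℝ (Δ i) x₀) (hΔ₀ : ∀ i, Δ i x₀ = 0) :
    ∃ N ∈ 𝓝 x₀, ∃ K : E → I → ℝ, ContDiffOn ℝ ∞ K N ∧ ∀ x ∈ N, g x = ∑ i, K x i * Δ i x := by
  classical
  obtain ⟨G, e, hmem, hsub, hfst, he, hes⟩ := exists_straightening hU hΔ hx₀ hli
  have hfst₀ : (e x₀).1 = 0 := by rw [hfst]; exact funext hΔ₀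
  obtain ⟨r, hr, hball⟩ := Metric.isOpen_iff.1 e.open_target (e x₀) (e.map_source hmem)
  -- Hadamard's lemma is applied to a globally defined function: g is cut off inside the chart and
  -- left unchanged on the ball of radius r / 4.
  let χ : ContDiffBump (e x₀) := ⟨r / 4, r / 2, by positivity, by linarith⟩
  have hχ : tsupport χ ⊆ e.target := by
    rw [χ.tsupport_eq]
    exact (Metric.closedBall_subset_ball (by change r / 2 < r; linarith)).trans hball
  let h : (I → ℝ) × G → ℝ := fun z => χ z * g (e.symm z)
  have hh : ContDiff ℝ ∞ h := by
    refine contDiff_iff_contDiffAt.2 fun z => ?_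
    by_cases hz : z ∈ tsupport χ
    · refine χ.contDiff.contDiffAt.mul ?_
      exact ((hg.comp hes fun y hy => hsub (e.map_target hy)).contDiffAt
        (e.open_target.mem_nhds (hχ hz)))
    · refine contDiffAt_const (c := (0 : ℝ)) |>.congr_of_eventuallyEq ?_
      filter_upwards [notMem_tsupport_iff_eventuallyEq.1 hz] with y hy
      simp [h, hy]
  have h0 : ∀ y, h (0, y) = 0 := by
    intro y
    by_cases hz : ((0 : I → ℝ), y) ∈ tsupport χ
    · have ht := hχ hz
      have hΔ0 : ∀ i, Δ i (e.symm (0, y)) = 0 := by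
        intro i
        have := hfst (e.symm (0, y))
        rw [e.right_inv ht] at this
        exact (congrFun this i).symm
      simp [h, hvan _ (hsub (e.map_target ht)) hΔ0]
    · simp [h, image_eq_zero_of_notMem_tsupport hz]
  obtain ⟨k, hk, hk'⟩ := exists_contDiff_clm_of_eq_zero hh h0
  refine ⟨e.source ∩ e ⁻¹' Metric.ball (e x₀) (r / 4), ?_, fun x i => k (e x) (Pi.single i 1),
    ?_, ?_⟩
  · exact (e.isOpen_inter_preimage Metric.isOpen_ball).mem_nhds
      ⟨hmem, Metric.mem_ball_self (by positivity)⟩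
  · refine contDiffOn_pi.2 fun i => ContDiffOn.mono ?_ inter_subset_left
    exact (hk.comp_contDiffOn he).clm_apply contDiffOn_const
  · intro x hx
    have h1 : χ (e x) = 1 := χ.one_of_mem_closedBall (Metric.ball_subset_closedBall hx.2)
    have h2 : g x = k (e x) (e x).1 := by
      rw [← hk', show h (e x) = χ (e x) * g (e.symm (e x)) from rfl, h1, e.left_inv hx.1, one_mul]
    rw [h2, ← ContinuousLinearMap.coe_coe, LinearMap.pi_apply_eq_sum_univ, hfst]
    refine Finset.sum_congr rfl fun i _ => ?_
    rw [smul_eq_mul, mul_comm, ContinuousLinearMap.coe_coe]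
    congr 2
    ext j
    simp [Pi.single_apply, eq_comm]

/-- Smooth functions with linearly independent differentials along their common zero set generate
the ideal of all smooth functions vanishing there. -/
theorem exists_multipliers {E I : Type} [NormedAddCommGroup E] [NormedSpace ℝ E]
    [FiniteDimensional ℝ E] [Fintype I] {U : Set E} (hU : IsOpen U) {Δ : I → E → ℝ}
    (hΔ : ∀ i, ContDiffOn ℝ ∞ (Δ i) U) {g : E → ℝ} (hg : ContDiffOn ℝ ∞ g U)
    (hvan : ∀ x ∈ U, (∀ i, Δ i x = 0) → g x = 0)
    (hli : ∀ x ∈ U, (∀ i, Δ i x = 0) → LinearIndependent ℝ fun i => fderiv ℝ (Δ i) x) :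
    ∃ K : E → I → ℝ, ContDiffOn ℝ ∞ K U ∧ ∀ x ∈ U, g x = ∑ i, K x i * Δ i x := by
  classical
  have hloc : ∀ x₀ ∈ U, ∃ N ∈ 𝓝 x₀, ∃ K : E → I → ℝ, ContDiffOn ℝ ∞ K N ∧
      ∀ x ∈ N, g x = ∑ i, K x i * Δ i x := by
    intro x₀ hx₀
    by_cases h0 : ∀ i, Δ i x₀ = 0
    · exact exists_local_multipliers hU hΔ hg hvan hx₀ (hli x₀ hx₀ h0) h0
    -- Off the common zero set some Δ i is nonzero nearby, and g / Δ i serves as the only nonzero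
    -- multiplier.
    · obtain ⟨i, hi⟩ := not_forall.1 h0
      have hN : IsOpen (U ∩ Δ i ⁻¹' {0}ᶜ) :=
        (hΔ i).continuousOn.isOpen_inter_preimage hU isOpen_compl_singleton
      refine ⟨_, hN.mem_nhds ⟨hx₀, hi⟩, fun x => Pi.single i (g x / Δ i x), ?_, ?_⟩
      · refine contDiffOn_pi.2 fun j => ?_
        by_cases hij : j = i
        · subst hij
          simp only [Pi.single_eq_same]
          exact (hg.mono inter_subset_left).div ((hΔ j).mono inter_subset_left) fun x hx => hx.2
        · simp only [Pi.single_eq_of_ne hij]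
          exact contDiffOn_const
      · intro x hx
        have : Δ i x ≠ 0 := hx.2
        simp only [Pi.single_apply, ite_mul, zero_mul, Finset.sum_ite_eq', Finset.mem_univ,
          if_true]
        field_simp
  let M : TopologicalSpace.Opens E := ⟨U, hU⟩
  have : LocallyCompactSpace M := hU.locallyCompactSpace
  obtain ⟨K, hK⟩ : ∃ K : ContMDiffMap (modelWithCornersSelf ℝ E) (modelWithCornersSelf ℝ (I → ℝ))
      M (I → ℝ) ∞, ∀ x : M, K x ∈ {c : I → ℝ | g x = ∑ i, c i * Δ i x} := by
    -- The admissible multipliers at each point form an affine, hence convex, set, so a partition of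
    -- unity glues local choices.
    refine exists_contMDiffMap_forall_mem_convex_of_local (n := ⊤) (modelWithCornersSelf ℝ E)
      (t := fun x : M => {c : I → ℝ | g x = ∑ i, c i * Δ i x}) ?_ ?_
    · intro x c hc d hd a b _ _ hab
      simp only [mem_ofPred_eq] at hc hd ⊢
      calc g x = a * g x + b * g x := by rw [← add_mul, hab, one_mul]
        _ = _ := by
          nth_rewrite 1 [hc]
          rw [hd, Finset.mul_sum, Finset.mul_sum, ← Finset.sum_add_distrib]
          refine Finset.sum_congr rfl fun i _ => ?_
          simp only [Pi.add_apply, Pi.smul_apply, smul_eq_mul]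
          ring
    · intro x
      obtain ⟨N, hN, K, hK, hK'⟩ := hloc x x.2
      refine ⟨Subtype.val ⁻¹' N, continuous_subtype_val.continuousAt.preimage_mem_nhds hN,
        fun y => K y, ?_, fun y hy => hK' y hy⟩
      exact (contMDiffOn_iff_contDiffOn.2 hK).comp contMDiff_subtype_val.contMDiffOn
        fun y hy => hy
  refine ⟨fun x => if h : x ∈ U then K ⟨x, h⟩ else 0, fun x hx => ?_, fun x hx => ?_⟩
  · refine ContDiffAt.contDiffWithinAt (contMDiffAt_iff_contDiffAt.1 ?_)
    refine (contMDiffAt_subtype_iff (U := M) (x := ⟨x, hx⟩)).1 ?_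
    refine (K.contMDiff ⟨x, hx⟩).congr_of_eventuallyEq (Eventually.of_forall fun y => ?_)
    exact dif_pos y.2
  · simpa [hx] using hK ⟨x, hx⟩

end SmoothDivision

namespace JetCalculus

/-! ### Differential functions and their directional derivatives -/

section JetFunctions

variable {p : ℕ} {ι : Type}

/-- The restriction of an infinite jet to finitely many coordinates. -/
abbrev proj (S : Finset (Coord p ι)) (z : Jet p ι) : S → ℝ := fun c => z c

/-- Openness makes the domain of a representing function open, so that it has genuine derivatives
there. -/
theorem isOpenMap_proj (S : Finset (Coord p ι)) : IsOpenMap (proj S) := by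
  classical
  exact isOpenMap_fst.comp
    (Homeomorph.piEquivPiSubtypeProd (fun c => c ∈ S) fun _ : Coord p ι => ℝ).isOpenMap

/-- On `W`, the function `P` is the smooth function `G` of the coordinates in `S`. -/
def Represents (W : Set (Jet p ι)) (P : Jet p ι → ℝ) (S : Finset (Coord p ι))
    (G : (S → ℝ) → ℝ) : Prop :=
  ContDiffOn ℝ ∞ G (proj S '' W) ∧ ∀ z ∈ W, P z = G (proj S z)

variable {W : Set (Jet p ι)} {P Q : Jet p ι → ℝ}

theorem Represents.mono {S T : Finset (Coord p ι)} {G : (S → ℝ) → ℝ} (h : Represents W P S G)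
    (hST : S ⊆ T) : Represents W P T fun y => G fun c => y ⟨c, hST c.2⟩ := by
  refine ⟨h.1.comp (contDiff_pi.2 fun c => contDiff_apply ..).contDiffOn ?_, fun z hz => h.2 z hz⟩
  rintro _ ⟨z, hz, rfl⟩
  exact ⟨z, hz, rfl⟩

theorem Represents.contDiffAt {S : Finset (Coord p ι)} {G : (S → ℝ) → ℝ}
    (h : Represents W P S G) (hW : IsOpen W) {z : Jet p ι} (hz : z ∈ W) :
    ContDiffAt ℝ ∞ G (proj S z) :=
  h.1.contDiffAt ((isOpenMap_proj S W hW).mem_nhds ⟨z, hz, rfl⟩)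

theorem eventually_add_smul_mem (hW : IsOpen W) {z : Jet p ι} (hz : z ∈ W) (h : Jet p ι) :
    ∀ᶠ t : ℝ in 𝓝 0, z + t • h ∈ W := by
  have hc : Continuous fun t : ℝ => z + t • h := by fun_prop
  exact hc.continuousAt.preimage_mem_nhds (by simpa using hW.mem_nhds hz)

theorem Represents.hasLineDerivAt {S : Finset (Coord p ι)} {G : (S → ℝ) → ℝ}
    (hG : Represents W P S G) (hW : IsOpen W) {z : Jet p ι} (hz : z ∈ W) (h : Jet p ι) :
    HasLineDerivAt ℝ P (fderiv ℝ G (proj S z) (proj S h)) z h := by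
  have h1 := (((hG.contDiffAt hW hz).differentiableAt (by simp)).hasFDerivAt).hasLineDerivAt
    (proj S h)
  refine HasDerivAt.congr_of_eventuallyEq h1 ?_
  filter_upwards [eventually_add_smul_mem hW hz h] with t ht
  exact hG.2 _ ht

theorem IsDiffFun.hasLineDerivAt (hP : IsDiffFun ∞ W P) (hW : IsOpen W) {z : Jet p ι}
    (hz : z ∈ W) (h : Jet p ι) : HasLineDerivAt ℝ P (lineDeriv ℝ P z h) z h := by
  obtain ⟨S, G, hG⟩ := hP
  exact (Represents.hasLineDerivAt hG hW hz h).lineDifferentiableAt.hasLineDerivAt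

theorem IsDiffFun.lineDeriv_add (hP : IsDiffFun ∞ W P) (hW : IsOpen W) {z : Jet p ι}
    (hz : z ∈ W) (h k : Jet p ι) :
    lineDeriv ℝ P z (h + k) = lineDeriv ℝ P z h + lineDeriv ℝ P z k := by
  obtain ⟨S, G, hG⟩ := hP
  have H := fun v => (Represents.hasLineDerivAt hG hW hz v).lineDeriv
  rw [H, H, H, ← map_add]
  rfl

theorem IsDiffFun.lineDeriv_sum (hP : IsDiffFun ∞ W P) (hW : IsOpen W) {z : Jet p ι}
    (hz : z ∈ W) {κ : Type} (s : Finset κ) (h : κ → Jet p ι) :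
    lineDeriv ℝ P z (∑ k ∈ s, h k) = ∑ k ∈ s, lineDeriv ℝ P z (h k) := by
  classical
  induction s using Finset.induction_on with
  | empty => simp [lineDeriv_zero]
  | insert a s ha ih => rw [Finset.sum_insert ha, Finset.sum_insert ha, hP.lineDeriv_add hW hz, ih]

theorem lineDeriv_congr_of_eqOn (hW : IsOpen W) (hPQ : EqOn P Q W) {z : Jet p ι} (hz : z ∈ W)
    (h : Jet p ι) : lineDeriv ℝ P z h = lineDeriv ℝ Q z h := by
  refine Filter.EventuallyEq.deriv_eq ?_
  filter_upwards [eventually_add_smul_mem hW hz h] with t ht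
  exact hPQ ht

theorem IsDiffFun.lineDeriv_mul (hP : IsDiffFun ∞ W P) (hQ : IsDiffFun ∞ W Q) (hW : IsOpen W)
    {z : Jet p ι} (hz : z ∈ W) (h : Jet p ι) :
    lineDeriv ℝ (fun w => P w * Q w) z h =
      lineDeriv ℝ P z h * Q z + P z * lineDeriv ℝ Q z h := by
  have := (HasDerivAt.mul (hP.hasLineDerivAt hW hz h) (hQ.hasLineDerivAt hW hz h)).deriv
  simp only [zero_smul, add_zero] at this
  exact this

theorem IsDiffFun.lineDeriv_add_fun (hP : IsDiffFun ∞ W P) (hQ : IsDiffFun ∞ W Q) (hW : IsOpen W)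
    {z : Jet p ι} (hz : z ∈ W) (h : Jet p ι) :
    lineDeriv ℝ (fun w => P w + Q w) z h = lineDeriv ℝ P z h + lineDeriv ℝ Q z h :=
  (HasDerivAt.add (hP.hasLineDerivAt hW hz h) (hQ.hasLineDerivAt hW hz h)).deriv

theorem IsDiffFun.lineDeriv_sub_fun (hP : IsDiffFun ∞ W P) (hQ : IsDiffFun ∞ W Q) (hW : IsOpen W)
    {z : Jet p ι} (hz : z ∈ W) (h : Jet p ι) :
    lineDeriv ℝ (fun w => P w - Q w) z h = lineDeriv ℝ P z h - lineDeriv ℝ Q z h :=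
  (HasDerivAt.sub (hP.hasLineDerivAt hW hz h) (hQ.hasLineDerivAt hW hz h)).deriv

theorem lineDeriv_sum_fun {κ : Type} (s : Finset κ) {R : κ → Jet p ι → ℝ}
    (hR : ∀ k ∈ s, IsDiffFun ∞ W (R k)) (hW : IsOpen W) {z : Jet p ι} (hz : z ∈ W)
    (h : Jet p ι) :
    lineDeriv ℝ (fun w => ∑ k ∈ s, R k w) z h = ∑ k ∈ s, lineDeriv ℝ (R k) z h :=
  (HasDerivAt.fun_sum fun k hk => (hR k hk).hasLineDerivAt hW hz h).deriv

theorem lineDeriv_coord (c : Coord p ι) (z h : Jet p ι) :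
    lineDeriv ℝ (fun w : Jet p ι => w c) z h = h c := by
  have : HasDerivAt (fun t : ℝ => z c + t * h c) (h c) 0 := by
    simpa using ((hasDerivAt_id (0 : ℝ)).mul_const (h c)).const_add (z c)
  exact this.deriv

theorem isDiffFun_const (a : ℝ) : IsDiffFun ∞ W fun _ => a :=
  ⟨∅, fun _ => a, contDiffOn_const, fun _ _ => rfl⟩

theorem isDiffFun_coord (c : Coord p ι) : IsDiffFun ∞ W fun z => z c :=
  ⟨{c}, fun y => y ⟨c, Finset.mem_singleton_self c⟩, (contDiff_apply ..).contDiffOn,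
    fun _ _ => rfl⟩

theorem IsDiffFun.congr (hP : IsDiffFun ∞ W P) (h : EqOn Q P W) : IsDiffFun ∞ W Q := by
  obtain ⟨S, G, hG, hG'⟩ := hP
  exact ⟨S, G, hG, fun z hz => (h hz).trans (hG' z hz)⟩

theorem IsDiffFun.comp₂ (hP : IsDiffFun ∞ W P) (hQ : IsDiffFun ∞ W Q) {m : ℝ × ℝ → ℝ}
    (hm : ContDiff ℝ ∞ m) : IsDiffFun ∞ W fun z => m (P z, Q z) := by
  classical
  obtain ⟨S, G, hG⟩ := hP
  obtain ⟨T, H, hH⟩ := hQ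
  have h1 := Represents.mono hG (Finset.subset_union_left (s₂ := T))
  have h2 := Represents.mono hH (Finset.subset_union_right (s₁ := S))
  exact ⟨S ∪ T, _, hm.comp_contDiffOn (h1.1.prodMk h2.1), fun z hz =>
    congrArg m (Prod.ext (h1.2 z hz) (h2.2 z hz))⟩

theorem IsDiffFun.add (hP : IsDiffFun ∞ W P) (hQ : IsDiffFun ∞ W Q) :
    IsDiffFun ∞ W fun z => P z + Q z :=
  hP.comp₂ hQ contDiff_add

theorem IsDiffFun.mul (hP : IsDiffFun ∞ W P) (hQ : IsDiffFun ∞ W Q) :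
    IsDiffFun ∞ W fun z => P z * Q z :=
  hP.comp₂ hQ contDiff_mul

theorem IsDiffFun.sub (hP : IsDiffFun ∞ W P) (hQ : IsDiffFun ∞ W Q) :
    IsDiffFun ∞ W fun z => P z - Q z :=
  hP.comp₂ hQ (contDiff_fst.sub contDiff_snd)

theorem isDiffFun_sum {κ : Type} (s : Finset κ) {R : κ → Jet p ι → ℝ}
    (hR : ∀ k ∈ s, IsDiffFun ∞ W (R k)) : IsDiffFun ∞ W fun z => ∑ k ∈ s, R k z := by
  classical
  induction s using Finset.induction_on with
  | empty => simpa using isDiffFun_const 0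
  | insert a s ha ih =>
    simp only [Finset.sum_insert ha]
    exact (hR a (Finset.mem_insert_self ..)).add
      (ih fun k hk => hR k (Finset.mem_insert_of_mem hk))

theorem isDiffFun_characteristic {ξ : Fin p → Jet p ι → ℝ} {φ : ι → Jet p ι → ℝ}
    (hξ : ∀ i, IsDiffFun ∞ W (ξ i)) (hφ : ∀ α, IsDiffFun ∞ W (φ α)) (α : ι) :
    IsDiffFun ∞ W (characteristic ξ φ α) :=
  (hφ α).sub (isDiffFun_sum _ fun i _ => (hξ i).mul (isDiffFun_coord _))

/-- The list of indices in which the index `i` occurs `J i` times, in increasing order. -/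
def indexList (J : Fin p → ℕ) : List (Fin p) :=
  (List.finRange p).flatMap fun i => List.replicate (J i) i

theorem length_indexList (J : Fin p → ℕ) : (indexList J).length = ∑ i, J i := by
  simp [indexList, List.length_flatMap, Fin.sum_univ_def]

/-- Folding over a list allows induction on one derivative at a time. -/
theorem multiIter_eq_foldr {A : Type} (T : Fin p → A → A) (J : Fin p → ℕ) (a : A) :
    multiIter T J a = (indexList J).foldr T a := by
  rw [indexList, List.foldr_flatMap, multiIter]
  congr
  funext i b
  induction J i with
  | zero => rfl
  | succ n ih => rw [Function.iterate_succ_apply', ih]; rfl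

/-! ### Total derivatives and prolongations as vector fields -/

section Derivations

variable [DecidableEq ι]

theorem partialD_eq_lineDeriv (c : Coord p ι) (P : Jet p ι → ℝ) (z : Jet p ι) :
    partialD c P z = lineDeriv ℝ P z (Pi.single c 1) := by
  have h : (fun t => P (Function.update z c t)) =
      fun t => (fun s : ℝ => P (z + s • (Pi.single c 1 : Jet p ι))) (t - z c) := by
    funext t
    refine congrArg P (funext fun d => ?_)
    by_cases hd : d = c
    · subst hd; simp
    · simp [hd]
  rw [partialD, h]
  refine (deriv_comp_sub_const (f := fun s : ℝ => P (z + s • (Pi.single c 1 : Jet p ι)))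
    (z c) (z c)).trans ?_
  rw [sub_self]
  rfl

theorem Represents.partialD_eq {S : Finset (Coord p ι)} {G : (S → ℝ) → ℝ}
    (hG : Represents W P S G) (hW : IsOpen W) {z : Jet p ι} (hz : z ∈ W) (c : Coord p ι) :
    partialD c P z = fderiv ℝ G (proj S z) (proj S (Pi.single c 1)) := by
  rw [partialD_eq_lineDeriv, (hG.hasLineDerivAt hW hz _).lineDeriv]

theorem Represents.partialD_eq_zero {S : Finset (Coord p ι)} {G : (S → ℝ) → ℝ}
    (hG : Represents W P S G) (hW : IsOpen W) {z : Jet p ι} (hz : z ∈ W) {c : Coord p ι}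
    (hc : c ∉ S) : partialD c P z = 0 := by
  have : proj S (Pi.single c 1 : Jet p ι) = 0 := by
    funext d
    have : (d : Coord p ι) ≠ c := fun h => hc (h ▸ d.2)
    simp [this]
  rw [hG.partialD_eq hW hz, this, map_zero]

theorem Represents.lineDeriv_eq_sum {S : Finset (Coord p ι)} {G : (S → ℝ) → ℝ}
    (hG : Represents W P S G) (hW : IsOpen W) {z : Jet p ι} (hz : z ∈ W) (h : Jet p ι) :
    lineDeriv ℝ P z h = ∑ c ∈ S, h c * partialD c P z := by
  rw [(hG.hasLineDerivAt hW hz h).lineDeriv, ← Finset.sum_coe_sort]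
  have : proj S h = ∑ c : S, h c • proj S (Pi.single (c : Coord p ι) 1) := by
    funext d
    simp [Finset.sum_apply, Pi.single_apply]
  rw [this, map_sum]
  refine Finset.sum_congr rfl fun c _ => ?_
  rw [map_smul, hG.partialD_eq hW hz, smul_eq_mul]

/-- Only the finitely many coordinates of a representation contribute, so the formal sum over all
derivatives is a directional derivative with no component along x. -/
theorem IsDiffFun.finsum_mul_partialD (hP : IsDiffFun ∞ W P) (hW : IsOpen W) {z : Jet p ι}
    (hz : z ∈ W) (X : ι × (Fin p → ℕ) → ℝ) :
    ∑ᶠ a, X a * partialD (Sum.inr a) P z = lineDeriv ℝ P z (Sum.elim 0 X) := by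
  obtain ⟨S, G, hG⟩ := hP
  rw [Represents.lineDeriv_eq_sum hG hW hz, ← Finset.toLeft_disjSum_toRight (u := S),
    Finset.sum_disjSum, finsum_eq_sum_of_support_subset (s := S.toRight)]
  · simp
  · intro a ha
    by_contra hS
    refine ha ?_
    simp only
    rw [Represents.partialD_eq_zero hG hW hz (by simpa using hS), mul_zero]

/-- The linear part of the total derivative field: it shifts the jet coordinates. -/
def shiftVec (i : Fin p) (z : Jet p ι) : Jet p ι :=
  Sum.elim 0 fun a => z (Sum.inr (a.1, a.2 + Pi.single i 1))

/-- The total derivative `D_i`, as a vector field on the infinite jet space. -/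
def totalVec (i : Fin p) (z : Jet p ι) : Jet p ι :=
  Pi.single (Sum.inl i) 1 + shiftVec i z

theorem IsDiffFun.totalD_eq (hP : IsDiffFun ∞ W P) (hW : IsOpen W) {z : Jet p ι}
    (hz : z ∈ W) (i : Fin p) : totalD i P z = lineDeriv ℝ P z (totalVec i z) := by
  rw [totalD, totalVec, hP.lineDeriv_add hW hz, partialD_eq_lineDeriv,
    hP.finsum_mul_partialD hW hz]
  rfl

/-- The prolongation of a generalised vector field, as a vector field on the infinite jet
space. -/
noncomputable def prolongVec (ξ : Fin p → Jet p ι → ℝ) (φ : ι → Jet p ι → ℝ) (z : Jet p ι) : Jet p ι :=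
  ∑ i, ξ i z • totalVec i z + Sum.elim (0 : Fin p → ℝ) fun a => totalDMulti a.2 (characteristic ξ φ a.1) z

theorem IsDiffFun.prolong_eq (hP : IsDiffFun ∞ W P) (hW : IsOpen W) {z : Jet p ι}
    (hz : z ∈ W) (ξ : Fin p → Jet p ι → ℝ) (φ : ι → Jet p ι → ℝ) :
    prolong ξ φ P z = lineDeriv ℝ P z (prolongVec ξ φ z) := by
  rw [prolong, prolongVec, hP.lineDeriv_add hW hz, hP.lineDeriv_sum hW hz,
    hP.finsum_mul_partialD hW hz]
  congr 1
  refine Finset.sum_congr rfl fun i _ => ?_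
  rw [hP.totalD_eq hW hz, _root_.lineDeriv_smul, smul_eq_mul]

theorem IsDiffFun.partialD (hP : IsDiffFun ∞ W P) (hW : IsOpen W) (c : Coord p ι) :
    IsDiffFun ∞ W (partialD c P) := by
  obtain ⟨S, G, hG⟩ := hP
  refine ⟨S, fun y => fderiv ℝ G y (proj S (Pi.single c 1)), ?_,
    fun z hz => Represents.partialD_eq hG hW hz c⟩
  exact (ContDiffOn.fderiv_of_isOpen hG.1 (isOpenMap_proj S W hW) (by simp)).clm_apply
    contDiffOn_const

theorem IsDiffFun.lineDeriv (hP : IsDiffFun ∞ W P) (hW : IsOpen W) {X : Jet p ι → Jet p ι}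
    (hX : ∀ c, IsDiffFun ∞ W fun z => X z c) :
    IsDiffFun ∞ W fun z => lineDeriv ℝ P z (X z) := by
  have hP' := hP
  obtain ⟨S, G, hG⟩ := hP'
  exact (isDiffFun_sum S fun c _ => (hX c).mul (hP.partialD hW c)).congr
    fun z hz => Represents.lineDeriv_eq_sum hG hW hz (X z)

theorem isDiffFun_totalVec (i : Fin p) (c : Coord p ι) :
    IsDiffFun ∞ W fun z => totalVec i z c :=
  (isDiffFun_const _).add (by cases c; exacts [isDiffFun_const 0, isDiffFun_coord _])

theorem IsDiffFun.totalD (hP : IsDiffFun ∞ W P) (hW : IsOpen W) (i : Fin p) :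
    IsDiffFun ∞ W (totalD i P) :=
  (hP.lineDeriv hW (isDiffFun_totalVec i)).congr fun _ hz => hP.totalD_eq hW hz i

theorem totalD_congr (hW : IsOpen W) (hPQ : EqOn P Q W) (i : Fin p) :
    EqOn (totalD i P) (totalD i Q) W := by
  intro z hz
  simp only [JetCalculus.totalD, partialD_eq_lineDeriv, lineDeriv_congr_of_eqOn hW hPQ hz]

theorem shiftVec_totalVec_comm (i j : Fin p) (z : Jet p ι) :
    shiftVec j (totalVec i z) = shiftVec i (totalVec j z) := by
  funext c
  cases c with
  | inl k => rfl
  | inr a => simp [shiftVec, totalVec, add_right_comm]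

/-- Since D_j P is dG applied to `totalVec j z`, the product rule gives a Hessian term and a term
from the field itself, which is affine in z with linear part `shiftVec j`. -/
theorem Represents.lineDeriv_totalD {S : Finset (Coord p ι)} {G : (S → ℝ) → ℝ}
    (hG : Represents W P S G) (hW : IsOpen W) {z : Jet p ι} (hz : z ∈ W) (j : Fin p)
    (h : Jet p ι) :
    _root_.lineDeriv ℝ (JetCalculus.totalD j P) z h =
      fderiv ℝ (fderiv ℝ G) (proj S z) (proj S h) (proj S (totalVec j z)) +
        fderiv ℝ G (proj S z) (proj S (shiftVec j h)) := by
  have hP : IsDiffFun ∞ W P := ⟨S, G, hG⟩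
  have h1 : HasDerivAt (fun t : ℝ => fderiv ℝ G (proj S z + t • proj S h))
      (fderiv ℝ (fderiv ℝ G) (proj S z) (proj S h)) 0 :=
    ((((hG.contDiffAt hW hz).fderiv_right (m := ∞) (by simp)).differentiableAt
      (by simp)).hasFDerivAt).hasLineDerivAt (proj S h)
  have h2 : HasDerivAt (fun t : ℝ => proj S (totalVec j z) + t • proj S (shiftVec j h))
      (proj S (shiftVec j h)) 0 := by
    simpa using ((hasDerivAt_id (0 : ℝ)).smul_const (proj S (shiftVec j h))).const_add
      (proj S (totalVec j z))
  have h3 := h1.clm_apply h2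
  simp only [zero_smul, add_zero] at h3
  refine HasDerivAt.deriv (h3.congr_of_eventuallyEq ?_)
  filter_upwards [eventually_add_smul_mem hW hz h] with t ht
  rw [hP.totalD_eq hW ht, (hG.hasLineDerivAt hW ht _).lineDeriv]
  congr 1
  funext c
  obtain ⟨c, hc⟩ := c
  cases c with
  | inl k => simp [proj, totalVec, shiftVec]
  | inr a => simp [proj, totalVec, shiftVec]

/-- The Hessian terms agree by symmetry of second derivatives, the remaining ones because shifts of
multi-indices commute. -/
theorem IsDiffFun.totalD_comm (hP : IsDiffFun ∞ W P) (hW : IsOpen W) (i j : Fin p) :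
    EqOn (JetCalculus.totalD i (JetCalculus.totalD j P))
      (JetCalculus.totalD j (JetCalculus.totalD i P)) W := by
  intro z hz
  rw [(hP.totalD hW j).totalD_eq hW hz, (hP.totalD hW i).totalD_eq hW hz]
  obtain ⟨S, G, hG⟩ := hP
  rw [Represents.lineDeriv_totalD hG hW hz, Represents.lineDeriv_totalD hG hW hz,
    shiftVec_totalVec_comm i j,
    (Represents.contDiffAt hG hW hz).isSymmSndFDerivAt (by simpa using ENat.LEInfty.out)]

theorem IsDiffFun.foldr_totalD (hP : IsDiffFun ∞ W P) (hW : IsOpen W) (l : List (Fin p)) :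
    IsDiffFun ∞ W (l.foldr JetCalculus.totalD P) := by
  induction l with
  | nil => exact hP
  | cons i l ih => exact ih.totalD hW i

theorem IsDiffFun.totalD_foldr_totalD (hP : IsDiffFun ∞ W P) (hW : IsOpen W) (i : Fin p)
    (l : List (Fin p)) :
    EqOn (JetCalculus.totalD i (l.foldr JetCalculus.totalD P))
      (l.foldr JetCalculus.totalD (JetCalculus.totalD i P)) W := by
  induction l with
  | nil => exact fun _ _ => rfl
  | cons j l ih =>
    exact ((hP.foldr_totalD hW l).totalD_comm hW i j).trans (totalD_congr hW ih j)

theorem IsDiffFun.totalDMulti (hP : IsDiffFun ∞ W P) (hW : IsOpen W) (J : Fin p → ℕ) :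
    IsDiffFun ∞ W (totalDMulti J P) := by
  rw [JetCalculus.totalDMulti, multiIter_eq_foldr]
  exact hP.foldr_totalD hW _

theorem IsDiffFun.negTotalDMulti (hP : IsDiffFun ∞ W P) (hW : IsOpen W) (J : Fin p → ℕ) :
    IsDiffFun ∞ W (negTotalDMulti J P) :=
  (isDiffFun_const _).mul (hP.totalDMulti hW J)

theorem isDiffFun_totalDiv {A : Fin p → Jet p ι → ℝ} (hA : ∀ i, IsDiffFun ∞ W (A i))
    (hW : IsOpen W) : IsDiffFun ∞ W (totalDiv A) :=
  isDiffFun_sum _ fun i _ => (hA i).totalD hW i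

theorem isDiffFun_prolongVec {ξ : Fin p → Jet p ι → ℝ} {φ : ι → Jet p ι → ℝ}
    (hξ : ∀ i, IsDiffFun ∞ W (ξ i)) (hφ : ∀ α, IsDiffFun ∞ W (φ α)) (hW : IsOpen W)
    (c : Coord p ι) : IsDiffFun ∞ W fun z => prolongVec ξ φ z c := by
  simp only [prolongVec, Pi.add_apply, Finset.sum_apply, Pi.smul_apply, smul_eq_mul]
  refine (isDiffFun_sum _ fun i _ => (hξ i).mul (isDiffFun_totalVec i c)).add ?_
  cases c with
  | inl j => exact isDiffFun_const 0
  | inr a => exact (isDiffFun_characteristic hξ hφ a.1).totalDMulti hW a.2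

theorem IsDiffFun.prolong (hP : IsDiffFun ∞ W P) {ξ : Fin p → Jet p ι → ℝ} {φ : ι → Jet p ι → ℝ}
    (hξ : ∀ i, IsDiffFun ∞ W (ξ i)) (hφ : ∀ α, IsDiffFun ∞ W (φ α)) (hW : IsOpen W) :
    IsDiffFun ∞ W (prolong ξ φ P) :=
  (hP.lineDeriv hW (isDiffFun_prolongVec hξ hφ hW)).congr fun _ hz => hP.prolong_eq hW hz ξ φ

/-! ### Divergences and integration by parts -/

/-- `R` is a divergence `D_i A^i` on `W`. -/
def IsDivergence (W : Set (Jet p ι)) (R : Jet p ι → ℝ) : Prop :=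
  ∃ A : Fin p → Jet p ι → ℝ, (∀ i, IsDiffFun ∞ W (A i)) ∧ ∀ z ∈ W, R z = totalDiv A z

theorem IsDivergence.congr {R R' : Jet p ι → ℝ} (h : IsDivergence W R) (hR : EqOn R' R W) :
    IsDivergence W R' := by
  obtain ⟨A, hA, hA'⟩ := h
  exact ⟨A, hA, fun z hz => (hR hz).trans (hA' z hz)⟩

theorem isDivergence_zero (hW : IsOpen W) : IsDivergence W fun _ : Jet p ι => 0 := by
  refine ⟨fun _ _ => 0, fun _ => isDiffFun_const 0, fun z hz => ?_⟩
  refine (Finset.sum_eq_zero fun i _ => ?_).symm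
  rw [(isDiffFun_const 0).totalD_eq hW hz]
  exact deriv_const ..

theorem IsDivergence.add {R R' : Jet p ι → ℝ} (hW : IsOpen W) (h : IsDivergence W R)
    (h' : IsDivergence W R') : IsDivergence W fun z => R z + R' z := by
  obtain ⟨A, hA, hA'⟩ := h
  obtain ⟨B, hB, hB'⟩ := h'
  refine ⟨fun i z => A i z + B i z, fun i => (hA i).add (hB i), fun z hz => ?_⟩
  simp only
  rw [hA' z hz, hB' z hz, totalDiv, totalDiv, totalDiv, ← Finset.sum_add_distrib]
  refine Finset.sum_congr rfl fun i _ => ?_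
  rw [((hA i).add (hB i)).totalD_eq hW hz, (hA i).totalD_eq hW hz, (hB i).totalD_eq hW hz,
    (hA i).lineDeriv_add_fun (hB i) hW hz]

theorem IsDivergence.sub {R R' : Jet p ι → ℝ} (hW : IsOpen W) (h : IsDivergence W R)
    (h' : IsDivergence W R') : IsDivergence W fun z => R z - R' z := by
  obtain ⟨A, hA, hA'⟩ := h
  obtain ⟨B, hB, hB'⟩ := h'
  refine ⟨fun i z => A i z - B i z, fun i => (hA i).sub (hB i), fun z hz => ?_⟩
  simp only
  rw [hA' z hz, hB' z hz, totalDiv, totalDiv, totalDiv, ← Finset.sum_sub_distrib]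
  refine Finset.sum_congr rfl fun i _ => ?_
  rw [((hA i).sub (hB i)).totalD_eq hW hz, (hA i).totalD_eq hW hz, (hB i).totalD_eq hW hz,
    (hA i).lineDeriv_sub_fun (hB i) hW hz]

theorem isDivergence_sum {κ : Type} (s : Finset κ) {R : κ → Jet p ι → ℝ} (hW : IsOpen W)
    (hR : ∀ k ∈ s, IsDivergence W (R k)) : IsDivergence W fun z => ∑ k ∈ s, R k z := by
  classical
  induction s using Finset.induction_on with
  | empty => simpa using isDivergence_zero hW
  | insert a s ha ih =>
    simp only [Finset.sum_insert ha]
    exact (hR a (Finset.mem_insert_self ..)).add hW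
      (ih fun k hk => hR k (Finset.mem_insert_of_mem hk))

theorem IsDiffFun.totalD_mul (hP : IsDiffFun ∞ W P) (hQ : IsDiffFun ∞ W Q) (hW : IsOpen W)
    {z : Jet p ι} (hz : z ∈ W) (i : Fin p) :
    JetCalculus.totalD i (fun w => P w * Q w) z =
      JetCalculus.totalD i P z * Q z + P z * JetCalculus.totalD i Q z := by
  rw [(hP.mul hQ).totalD_eq hW hz, hP.totalD_eq hW hz, hQ.totalD_eq hW hz,
    hP.lineDeriv_mul hQ hW hz]

theorem IsDiffFun.isDivergence_totalD (hP : IsDiffFun ∞ W P) (hW : IsOpen W) (i : Fin p) :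
    IsDivergence W (JetCalculus.totalD i P) := by
  refine ⟨fun j z => if j = i then P z else 0, fun j => ?_, fun z hz => ?_⟩
  · simp only
    split_ifs
    exacts [hP, isDiffFun_const 0]
  · rw [totalDiv, Finset.sum_eq_single i]
    · simp
    · intro j _ hj
      simp only [hj, if_false]
      rw [(isDiffFun_const 0).totalD_eq hW hz]
      exact deriv_const ..
    · simp

/-- Each step moves the outermost D_i by P D_i R = D_i(P R) - (D_i P) R and applies the induction
hypothesis to D_i P; commutativity then restores the order of the derivatives on P. -/
theorem IsDiffFun.isDivergence_foldr (hP : IsDiffFun ∞ W P) (hQ : IsDiffFun ∞ W Q)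
    (hW : IsOpen W) (l : List (Fin p)) :
    IsDivergence W fun z => P z * l.foldr JetCalculus.totalD Q z -
      (-1) ^ l.length * l.foldr JetCalculus.totalD P z * Q z := by
  induction l generalizing P with
  | nil => simpa using isDivergence_zero hW
  | cons i l ih =>
    have hQl := hQ.foldr_totalD hW l
    have h1 := (hP.mul hQl).isDivergence_totalD hW i
    have h2 := ih (hP.totalD hW i)
    refine (h1.sub hW h2).congr fun z hz => ?_
    simp only [List.foldr_cons, List.length_cons]
    rw [hP.totalD_mul hQl hW hz, hP.totalD_foldr_totalD hW i l hz]
    ring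

theorem IsDiffFun.isDivergence_integration_by_parts (hP : IsDiffFun ∞ W P)
    (hQ : IsDiffFun ∞ W Q) (hW : IsOpen W) (J : Fin p → ℕ) :
    IsDivergence W fun z => P z * JetCalculus.totalDMulti J Q z -
      JetCalculus.negTotalDMulti J P z * Q z := by
  simp only [JetCalculus.negTotalDMulti, JetCalculus.totalDMulti, multiIter_eq_foldr,
    ← length_indexList]
  exact hP.isDivergence_foldr hQ hW _

end Derivations

end JetFunctions

/-! ### Pullback to the jet space of (u, v) and the extended symmetry -/

section Pullback

variable {p : ℕ} {ι : Type} {W : Set (Jet p ι)} {P : Jet p ι → ℝ}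

theorem continuous_forgetV : Continuous (forgetV : Jet p (ι ⊕ ι) → Jet p ι) := by
  refine continuous_pi fun c => ?_
  cases c with
  | inl i => exact continuous_apply _
  | inr a => exact continuous_apply _

theorem forgetV_add_smul (z h : Jet p (ι ⊕ ι)) (t : ℝ) :
    forgetV (z + t • h) = forgetV z + t • forgetV h := by
  funext c
  cases c <;> rfl

theorem lineDeriv_comp_forgetV (P : Jet p ι → ℝ) (z h : Jet p (ι ⊕ ι)) :
    lineDeriv ℝ (fun w => P (forgetV w)) z h = lineDeriv ℝ P (forgetV z) (forgetV h) := by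
  simp only [lineDeriv, forgetV_add_smul]

theorem IsDiffFun.comp_forgetV (hP : IsDiffFun ∞ W P) :
    IsDiffFun ∞ (forgetV ⁻¹' W) fun z => P (forgetV z) := by
  classical
  obtain ⟨S, G, hG, hG'⟩ := hP
  let e : Coord p ι → Coord p (ι ⊕ ι) :=
    Sum.elim Sum.inl fun a => Sum.inr (Sum.inl a.1, a.2)
  have he : ∀ (z : Jet p (ι ⊕ ι)) c, forgetV z c = z (e c) := fun z c => by cases c <;> rfl
  refine ⟨S.image e, fun y => G fun c => y ⟨e c, Finset.mem_image_of_mem e c.2⟩, ?_,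
    fun z hz => ?_⟩
  · refine hG.comp (contDiff_pi.2 fun c => contDiff_apply ..).contDiffOn ?_
    rintro _ ⟨z, hz, rfl⟩
    exact ⟨forgetV z, hz, funext fun c => he z c⟩
  · exact (hG' _ hz).trans (congrArg G (funext fun c => he z c))

theorem isDiffFun_vSubU {V : Set (Jet p (ι ⊕ ι))} (α : ι) : IsDiffFun ∞ V (vSubU α) :=
  (isDiffFun_coord _).sub (isDiffFun_coord _)

theorem genericLagrangian_eq_sum [Fintype ι] (F : ι → Jet p ι → ℝ) :
    genericLagrangian F = fun z => ∑ α, vSubU α z * F α (forgetV z) := by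
  funext z
  simp only [genericLagrangian, vSubU, sub_mul, Finset.sum_sub_distrib]

variable [DecidableEq ι]

/-- The total derivative fields of the two jet spaces are related by the projection; hence total
derivatives commute with pullback. -/
theorem forgetV_totalVec (i : Fin p) (z : Jet p (ι ⊕ ι)) :
    forgetV (totalVec i z) = totalVec i (forgetV z) := by
  funext c
  cases c with
  | inl j => simp [forgetV, totalVec, shiftVec, Pi.single_apply]
  | inr a => simp [forgetV, totalVec, shiftVec]

theorem IsDiffFun.totalD_comp_forgetV (hP : IsDiffFun ∞ W P) (hW : IsOpen W) (i : Fin p) :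
    EqOn (JetCalculus.totalD i fun z => P (forgetV z)) (fun z => JetCalculus.totalD i P (forgetV z)) (forgetV ⁻¹' W) := by
  intro z hz
  simp only
  rw [hP.comp_forgetV.totalD_eq (hW.preimage continuous_forgetV) hz, hP.totalD_eq hW hz,
    lineDeriv_comp_forgetV, forgetV_totalVec]

theorem IsDiffFun.totalDMulti_comp_forgetV (hP : IsDiffFun ∞ W P) (hW : IsOpen W)
    (J : Fin p → ℕ) :
    EqOn (JetCalculus.totalDMulti J fun z => P (forgetV z)) (fun z => JetCalculus.totalDMulti J P (forgetV z))
      (forgetV ⁻¹' W) := by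
  suffices H : ∀ l : List (Fin p), EqOn (l.foldr JetCalculus.totalD fun z => P (forgetV z))
      (fun z => l.foldr JetCalculus.totalD P (forgetV z)) (forgetV ⁻¹' W) by
    rw [JetCalculus.totalDMulti, JetCalculus.totalDMulti, multiIter_eq_foldr, multiIter_eq_foldr]
    exact H _
  intro l
  induction l with
  | nil => exact fun _ _ => rfl
  | cons i l ih =>
    exact (totalD_congr (hW.preimage continuous_forgetV) ih i).trans
      ((hP.foldr_totalD hW l).totalD_comp_forgetV hW i)

/-- The transport term ξ^i u^α_i cancels the one subtracted in the characteristic. -/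
theorem prolongVec_zero (ξ : Fin p → Jet p ι → ℝ) (φ : ι → Jet p ι → ℝ) (z : Jet p ι) (α : ι) :
    prolongVec ξ φ z (Sum.inr (α, 0)) = φ α z := by
  have h0 : totalDMulti 0 (characteristic ξ φ α) = characteristic ξ φ α := by
    rw [totalDMulti, multiIter_eq_foldr, List.eq_nil_of_length_eq_zero (l := indexList 0)]
    · rfl
    · simp [length_indexList]
  simp [prolongVec, totalVec, shiftVec, h0, characteristic, Finset.sum_apply]

/-- The coefficients `φs` enter only the v-components, which the projection discards. -/
theorem forgetV_prolongVec {ξ : Fin p → Jet p ι → ℝ} {φ : ι → Jet p ι → ℝ}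
    (hξ : ∀ i, IsDiffFun ∞ W (ξ i)) (hφ : ∀ α, IsDiffFun ∞ W (φ α)) (hW : IsOpen W)
    (φs : ι → Jet p (ι ⊕ ι) → ℝ) {z : Jet p (ι ⊕ ι)} (hz : forgetV z ∈ W) :
    forgetV (prolongVec (liftXi ξ) (extendPhi φ φs) z) = prolongVec ξ φ (forgetV z) := by
  funext c
  have hc := fun i => congrFun (forgetV_totalVec i z) c
  cases c with
  | inl j =>
    simp only [forgetV, Sum.elim_inl] at hc
    simp [forgetV, prolongVec, Finset.sum_apply, hc, liftXi]
  | inr a =>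
    simp only [forgetV, Sum.elim_inr] at hc
    have h := (isDiffFun_characteristic hξ hφ a.1).totalDMulti_comp_forgetV hW a.2 hz
    simp only [forgetV, prolongVec, Finset.sum_apply, Pi.add_apply, Pi.smul_apply, hc, liftXi,
      Sum.elim_inr]
    exact congrArg _ h

theorem prolong_genericLagrangian [Fintype ι] {F : ι → Jet p ι → ℝ}
    (hF : ∀ α, IsDiffFun ∞ W (F α)) {ξ : Fin p → Jet p ι → ℝ} {φ : ι → Jet p ι → ℝ}
    (hξ : ∀ i, IsDiffFun ∞ W (ξ i)) (hφ : ∀ α, IsDiffFun ∞ W (φ α)) (hW : IsOpen W)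
    (φs : ι → Jet p (ι ⊕ ι) → ℝ) {z : Jet p (ι ⊕ ι)} (hz : forgetV z ∈ W) :
    prolong (liftXi ξ) (extendPhi φ φs) (genericLagrangian F) z =
      ∑ α, ((φs α z - φ α (forgetV z)) * F α (forgetV z) +
        vSubU α z * prolong ξ φ (F α) (forgetV z)) := by
  have hW' : IsOpen (forgetV ⁻¹' W) := hW.preimage continuous_forgetV
  have hterm : ∀ α ∈ Finset.univ, IsDiffFun ∞ (forgetV ⁻¹' W)
      fun z => vSubU α z * F α (forgetV z) :=
    fun α _ => (isDiffFun_vSubU α).mul (hF α).comp_forgetV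
  rw [genericLagrangian_eq_sum, (isDiffFun_sum _ hterm).prolong_eq hW' hz,
    lineDeriv_sum_fun _ hterm hW' hz]
  refine Finset.sum_congr rfl fun α _ => ?_
  rw [(isDiffFun_vSubU α).lineDeriv_mul (hF α).comp_forgetV hW' hz, lineDeriv_comp_forgetV,
    forgetV_prolongVec hξ hφ hW φs hz, (hF α).prolong_eq hW hz]
  congr 2
  change lineDeriv ℝ (fun w : Jet p (ι ⊕ ι) => w (Sum.inr (Sum.inr α, 0)) -
    w (Sum.inr (Sum.inl α, 0))) z _ = _
  rw [(isDiffFun_coord _).lineDeriv_sub_fun (isDiffFun_coord _) hW' hz, lineDeriv_coord,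
    lineDeriv_coord, prolongVec_zero, prolongVec_zero]
  rfl

variable [Fintype ι] {F : ι → Jet p ι → ℝ} {ξ : Fin p → Jet p ι → ℝ} {φ : ι → Jet p ι → ℝ}
  {𝒥 : Finset (Fin p → ℕ)} {K : (Fin p → ℕ) → ι → ι → Jet p ι → ℝ}

theorem isDiffFun_phiStar (hW : IsOpen W) (hξ : ∀ i, IsDiffFun ∞ W (ξ i))
    (hφ : ∀ α, IsDiffFun ∞ W (φ α)) (hK : ∀ J ∈ 𝒥, ∀ α β, IsDiffFun ∞ W (K J α β)) (α : ι) :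
    IsDiffFun ∞ (forgetV ⁻¹' W) (phiStar ξ φ 𝒥 K α) := by
  have hW' : IsOpen (forgetV ⁻¹' W) := hW.preimage continuous_forgetV
  refine ((hφ α).comp_forgetV.sub (isDiffFun_sum _ fun β _ => isDiffFun_sum _ fun J hJ => ?_)).sub
    ((isDiffFun_vSubU α).mul (isDiffFun_totalDiv (fun i => (hξ i).comp_forgetV) hW'))
  exact ((isDiffFun_vSubU β).mul (hK J hJ β α).comp_forgetV).negTotalDMulti hW' J

/-- With this φ_* the invariance expression is exactly the sum of the integration-by-parts defects,
each a divergence; the last term of φ_* cancels L̂ D_i ξ^i. -/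
theorem isVariationalSymmetry_phiStar (hW : IsOpen W) (hF : ∀ α, IsDiffFun ∞ W (F α))
    (hξ : ∀ i, IsDiffFun ∞ W (ξ i)) (hφ : ∀ α, IsDiffFun ∞ W (φ α))
    (hK : IsSymmetryMultiplier W F ξ φ 𝒥 K) :
    IsVariationalSymmetry (forgetV ⁻¹' W) (genericLagrangian F) (liftXi ξ)
      (extendPhi φ (phiStar ξ φ 𝒥 K)) := by
  have hW' : IsOpen (forgetV ⁻¹' W) := hW.preimage continuous_forgetV
  have hdiv : IsDivergence (forgetV ⁻¹' W) fun z => ∑ α, ∑ β, ∑ J ∈ 𝒥,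
      ((vSubU β z * K J β α (forgetV z)) * totalDMulti J (fun w => F α (forgetV w)) z -
        negTotalDMulti J (fun w => vSubU β w * K J β α (forgetV w)) z * F α (forgetV z)) :=
    isDivergence_sum _ hW' fun α _ => isDivergence_sum _ hW' fun β _ =>
      isDivergence_sum _ hW' fun J hJ =>
        ((isDiffFun_vSubU β).mul (hK.1 J hJ β α).comp_forgetV).isDivergence_integration_by_parts
          (hF α).comp_forgetV hW' J
  refine hdiv.congr fun z hz => ?_
  simp only
  rw [prolong_genericLagrangian hF hξ hφ hW _ hz, genericLagrangian_eq_sum]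
  simp only [Finset.sum_sub_distrib, Finset.sum_add_distrib]
  -- Exchanging α and β collects the terms by the function F_α being differentiated, which explains
  -- the transposed indices of K in φ_*.
  have h1 : ∑ α, vSubU α z * prolong ξ φ (F α) (forgetV z) =
      ∑ α, ∑ β, ∑ J ∈ 𝒥, vSubU β z * K J β α (forgetV z) *
        totalDMulti J (fun w => F α (forgetV w)) z := by
    rw [Finset.sum_comm]
    refine Finset.sum_congr rfl fun α _ => ?_
    rw [hK.2 _ hz, Finset.mul_sum]
    refine Finset.sum_congr rfl fun β _ => ?_
    rw [Finset.mul_sum]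
    refine Finset.sum_congr rfl fun J _ => ?_
    rw [(hF β).totalDMulti_comp_forgetV hW J hz, mul_assoc]
  rw [h1, Finset.sum_mul, add_right_comm, ← Finset.sum_add_distrib, add_comm, sub_eq_add_neg,
    ← Finset.sum_neg_distrib]
  congr 1
  refine Finset.sum_congr rfl fun α _ => ?_
  simp only [phiStar, ← Finset.sum_mul]
  ring

end Pullback

/-! ### Existence of multipliers from total nondegeneracy -/

section Multipliers

variable {p : ℕ} {ι : Type}

theorem finite_multiIndex (k : ℕ) : {J : Fin p → ℕ | ∑ i, J i ≤ k}.Finite :=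
  (Set.finite_Iic fun _ => k).subset fun _ hJ i =>
    (Finset.single_le_sum (fun _ _ => Nat.zero_le _) (Finset.mem_univ i)).trans hJ

variable [DecidableEq ι]

/-- A relation between the differentials, evaluated on projected coordinate vectors, is a relation
between the full Jacobian rows; entries outside T vanish on both sides. -/
theorem Represents.linearIndependent_fderiv {W : Set (Jet p ι)} (hW : IsOpen W) {I : Type}
    [Fintype I] {R : I → Jet p ι → ℝ} {T : Finset (Coord p ι)} {D : I → (T → ℝ) → ℝ}
    (hD : ∀ a, Represents W (R a) T (D a)) {z : Jet p ι} (hz : z ∈ W)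
    (hli : LinearIndependent ℝ fun (a : I) (c : Coord p ι) => partialD c (R a) z) :
    LinearIndependent ℝ fun a => fderiv ℝ (D a) (proj T z) := by
  refine Fintype.linearIndependent_iff.2 fun g hg => Fintype.linearIndependent_iff.1 hli g ?_
  funext c
  have := DFunLike.congr_fun hg (proj T (Pi.single c 1))
  simpa [Finset.sum_apply, (hD _).partialD_eq hW hz] using this

theorem exists_isSymmetryMultiplier [Fintype ι] {n : ℕ} {W : Set (Jet p ι)} (hW : IsOpen W)
    {F : ι → Jet p ι → ℝ} (hF : ∀ α, IsDiffFun ∞ W (F α))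
    (hnd : IsTotallyNondegenerate n W F) {ξ : Fin p → Jet p ι → ℝ} {φ : ι → Jet p ι → ℝ}
    (hξ : ∀ i, IsDiffFun ∞ W (ξ i)) (hφ : ∀ α, IsDiffFun ∞ W (φ α))
    (hX : IsSymmetry W F ξ φ) :
    ∃ (𝒥 : Finset (Fin p → ℕ)) (K : (Fin p → ℕ) → ι → ι → Jet p ι → ℝ),
      IsSymmetryMultiplier W F ξ φ 𝒥 K := by
  classical
  choose S G hG using fun α => (hF α).prolong hξ hφ hW
  have hG : ∀ α, Represents W (prolong ξ φ (F α)) (S α) (G α) := hG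
  -- This k bounds the order of every coordinate used to represent pr X(F_α), so agreement of jets
  -- up to order n + k determines its value.
  let k := (Finset.univ.biUnion S).sup coordOrder
  have hk : ∀ α, ∀ c ∈ S α, coordOrder c ≤ k := fun α c hc =>
    Finset.le_sup (f := coordOrder) (Finset.mem_biUnion.2 ⟨α, Finset.mem_univ α, hc⟩)
  have hfin := finite_multiIndex (p := p) k
  have : Fintype {J : Fin p → ℕ // ∑ i, J i ≤ k} := hfin.fintype
  let I := ι × {J : Fin p → ℕ // ∑ i, J i ≤ k}
  choose S' D hD using fun a : I => (hF a.1).totalDMulti hW a.2.1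
  have hD : ∀ a : I, Represents W (totalDMulti a.2.1 (F a.1)) (S' a) (D a) := hD
  let T := Finset.univ.biUnion S ∪ Finset.univ.biUnion S'
  have hST : ∀ α, S α ⊆ T := fun α =>
    (Finset.subset_biUnion_of_mem S (Finset.mem_univ α)).trans Finset.subset_union_left
  have hST' : ∀ a, S' a ⊆ T := fun a =>
    (Finset.subset_biUnion_of_mem S' (Finset.mem_univ a)).trans Finset.subset_union_right
  have hGT := fun α => (hG α).mono (hST α)
  have hDT := fun a => (hD a).mono (hST' a)
  have hon : ∀ z ∈ W, (∀ a : I, totalDMulti a.2.1 (F a.1) z = 0) → OnProlongedSystem k W F z :=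
    fun z hz h => ⟨hz, fun α J hJ => h (α, ⟨J, hJ⟩)⟩
  have hvan : ∀ z ∈ W, (∀ a : I, totalDMulti a.2.1 (F a.1) z = 0) →
      ∀ α, prolong ξ φ (F α) z = 0 := by
    intro z hz h α
    -- The symmetry condition concerns solutions only; local solvability transfers it to every point
    -- of the prolonged system.
    obtain ⟨V, f, hV, hf, hagree⟩ := (hnd k).2 z (hon z hz h)
    rw [← hX V f hf _ hV α, (hG α).2 z hz, (hG α).2 _ (hf.mem _ hV)]
    exact congrArg (G α) (funext fun c =>
      (hagree c ((hk α c c.2).trans (Nat.le_add_left k n))).symm)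
  have hmult := fun α => exists_multipliers (isOpenMap_proj T W hW) (fun a => (hDT a).1)
    (hGT α).1 ?_ ?_
  · choose K hK hK' using hmult
    -- Only |J| ≤ k enters the sum; the value 0 for other J is a filler.
    refine ⟨hfin.toFinset, fun J α β z =>
      if hJ : ∑ i, J i ≤ k then K α (proj T z) (β, ⟨J, hJ⟩) else 0, ?_, ?_⟩
    · intro J hJ α β
      have hJ : ∑ i, J i ≤ k := by simpa using hJ
      simp only [hJ, dif_pos]
      exact ⟨T, fun y => K α y (β, ⟨J, hJ⟩), contDiffOn_pi.1 (hK α) _, fun _ _ => rfl⟩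
    · intro z hz α
      refine ((hGT α).2 z hz).trans ((hK' α _ ⟨z, hz, rfl⟩).trans ?_)
      rw [Fintype.sum_prod_type]
      refine Finset.sum_congr rfl fun β _ => ?_
      rw [Finset.sum_subtype (p := fun J : Fin p → ℕ => ∑ i, J i ≤ k) _ (by simp)]
      refine Finset.sum_congr rfl fun J _ => ?_
      simp only [J.2, dif_pos]
      rw [(hDT (β, J)).2 z hz]
  · rintro _ ⟨z, hz, rfl⟩ h
    exact ((hGT α).2 z hz).symm.trans (hvan z hz (fun a => ((hDT a).2 z hz).trans (h a)) α)
  · rintro _ ⟨z, hz, rfl⟩ h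
    exact Represents.linearIndependent_fderiv hW hDT hz
      ((hnd k).1 z (hon z hz fun a => ((hDT a).2 z hz).trans (h a)))

end Multipliers

end JetCalculus

end

theorem theorem3p2 (p q n : ℕ)
    (W : Set (Jet p (Fin q))) (hW : IsJetDomain n W)
    (F : Fin q → Jet p (Fin q) → ℝ)
    (hF_analytic : ∀ α, IsDiffFun ω W (F α))
    (hF_order : ∀ α, HasOrderLE n W (F α))
    (hF_nondeg : IsTotallyNondegenerate n W F)
    (ξ : Fin p → Jet p (Fin q) → ℝ) (hξ : ∀ i, IsDiffFun ∞ W (ξ i))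
    (φ : Fin q → Jet p (Fin q) → ℝ) (hφ : ∀ α, IsDiffFun ∞ W (φ α))
    (hX : IsSymmetry W F ξ φ) :
    -- `X` extends to a variational symmetry of the generic modified formal functional
    (∃ φs : Fin q → Jet p (Fin q ⊕ Fin q) → ℝ,
      (∀ α, IsDiffFun ∞ (forgetV ⁻¹' W) (φs α)) ∧
      IsVariationalSymmetry (forgetV ⁻¹' W) (genericLagrangian F)
        (liftXi ξ) (extendPhi φ φs)) ∧
    -- multipliers in the linearized symmetry condition exist
    (∃ (𝒥 : Finset (Fin p → ℕ)) (K : (Fin p → ℕ) → Fin q → Fin q → Jet p (Fin q) → ℝ),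
      IsSymmetryMultiplier W F ξ φ 𝒥 K) ∧
    -- every choice of multipliers gives an explicit extension
    (∀ (𝒥 : Finset (Fin p → ℕ)) (K : (Fin p → ℕ) → Fin q → Fin q → Jet p (Fin q) → ℝ),
      IsSymmetryMultiplier W F ξ φ 𝒥 K →
        (∀ α, IsDiffFun ∞ (forgetV ⁻¹' W) (phiStar ξ φ 𝒥 K α)) ∧
        IsVariationalSymmetry (forgetV ⁻¹' W) (genericLagrangian F)
          (liftXi ξ) (extendPhi φ (phiStar ξ φ 𝒥 K))) := by
  have hF : ∀ α, IsDiffFun ∞ W (F α) := fun α => by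
    obtain ⟨S, G, hG, hG'⟩ := hF_analytic α
    exact ⟨S, G, hG.of_le le_top, hG'⟩
  have hmult := exists_isSymmetryMultiplier hW.isOpen hF hF_nondeg hξ hφ hX
  have hstar : ∀ (𝒥 : Finset (Fin p → ℕ)) (K : (Fin p → ℕ) → Fin q → Fin q → Jet p (Fin q) → ℝ),
      IsSymmetryMultiplier W F ξ φ 𝒥 K →
        (∀ α, IsDiffFun ∞ (forgetV ⁻¹' W) (phiStar ξ φ 𝒥 K α)) ∧
        IsVariationalSymmetry (forgetV ⁻¹' W) (genericLagrangian F)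
          (liftXi ξ) (extendPhi φ (phiStar ξ φ 𝒥 K)) := fun 𝒥 K hK =>
    ⟨isDiffFun_phiStar hW.isOpen hξ hφ hK.1, isVariationalSymmetry_phiStar hW.isOpen hF hξ hφ hK⟩
  obtain ⟨𝒥, K, hK⟩ := hmult
  exact ⟨⟨phiStar ξ φ 𝒥 K, hstar 𝒥 K hK⟩, ⟨𝒥, K, hK⟩, hstar⟩
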